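/- Let $m,n\in\mathbb{N}$ with $m\ge 1$, and fix a set $E\subset\mathbb{R}^n$. Let the rows $a_1,\dots,a_m$ of a random matrix $A\in\mathbb{R}^{m\times n}$ be independent copies of a random vector $a\in\mathbb{R}^n$. Let $B\in\mathbb{R}^{\lfloor m/2\rfloor\times n}$ be the matrix with rows $b_i=(a_{2i-1}-a_{2i})/\sqrt2$, $1\le i\le\lfloor m/2\rfloor$, and let $b=(a-a')/\sqrt2$, where $a'$ is an independent copy of $a$, so that each $b_i$ is distributed as $b$. Let $\epsilon_1,\dots,\epsilon_{\lfloor m/2\rfloor}$ be a Rademacher sequence (independent signs, each $\pm1$ with probability $1/2$) independent of $A$, and put $h=\frac{1}{\sqrt{\lfloor m/2\rfloor}}\sum_{k=1}^{\lfloor m/2\rfloor}\epsilon_k b_k$ (with $h=0$ if $m=1$). For $\xi>0$ define $$Q_{\xi}(E,b)=\inf_{u\in E}\mathbb{P}\left(|\langle b,u\rangle|\ge\xi\right),\qquad W_{\lfloor m/2\rfloor}(E,b)=\mathbb{E}\left[\sup_{u\in E}\langle h,u\rangle\right],$$ and assume that the expectation defining $W_{\lfloor m/2\rfloor}(E,b)$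 exists in $[-\infty,\infty]$, i.e. that the positive or the negative part of $\sup_{u\in E}\langle h,u\rangle$ has finite expectation. Then for all $t>0$ and $\xi>0$, with probability at least $1-e^{-2t^2}$, $$\inf_{v\in E}\|Av\|_2\ \ge\ \xi\sqrt{\frac{m-1}{2}}\;Q_{2\xi}(E,b)-\xi t-2W_{\lfloor m/2\rfloor}(E,b).$$ -/

import Mathlib

open MeasureTheory ProbabilityTheory
open scoped ENNReal

noncomputable section

namespace SmallBall

/-- Expectation of an extended-real random variable, `E[X⁺] - E[X⁻]`, with values in `[-∞, ∞]`.
It is meaningful when `ExpectationExists μ X`. -/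
def expectation {Ω : Type*} [MeasurableSpace Ω] (μ : Measure Ω) (X : Ω → EReal) : EReal :=
  ((∫⁻ ω, (X ω).toENNReal ∂μ : ℝ≥0∞) : EReal) - ((∫⁻ ω, (-X ω).toENNReal ∂μ : ℝ≥0∞) : EReal)

/-- The expectation is not of the undefined form `∞ - ∞`. -/
def ExpectationExists {Ω : Type*} [MeasurableSpace Ω] (μ : Measure Ω) (X : Ω → EReal) : Prop :=
  ∫⁻ ω, (X ω).toENNReal ∂μ ≠ ∞ ∨ ∫⁻ ω, (-X ω).toENNReal ∂μ ≠ ∞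

/-- The `i`-th row of a matrix, as a vector of Euclidean space. -/
def row {m n : ℕ} (A : Matrix (Fin m) (Fin n) ℝ) (i : Fin m) : EuclideanSpace ℝ (Fin n) :=
  WithLp.toLp 2 (A i)

/-- The matrix with the `⌊m/2⌋` rows `(a_{2i-1} - a_{2i}) / √2`, `1 ≤ i ≤ ⌊m/2⌋`
(in zero-based indexing, `(a_{2i} - a_{2i+1}) / √2`, `0 ≤ i < ⌊m/2⌋`). -/
def debias {m n : ℕ} (A : Matrix (Fin m) (Fin n) ℝ) : Matrix (Fin (m / 2)) (Fin n) ℝ :=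
  fun i j => (A ⟨2 * i.1, by omega⟩ j - A ⟨2 * i.1 + 1, by omega⟩ j) / √2

/-- The random vector `b = (a - a') / √2`, where `a'` is an independent copy of `a`,
realized on the product space. -/
def debiasedVector {Ω₀ : Type*} {n : ℕ} (a : Ω₀ → EuclideanSpace ℝ (Fin n)) :
    Ω₀ × Ω₀ → EuclideanSpace ℝ (Fin n) :=
  fun p => (√2)⁻¹ • (a p.1 - a p.2)

/-- `Q_ξ(E, X) = inf_{u ∈ E} P(|⟨X, u⟩| ≥ ξ)`. -/
def Q {Ω : Type*} [MeasurableSpace Ω] {n : ℕ} (μ : Measure Ω) (ξ : ℝ)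
    (E : Set (EuclideanSpace ℝ (Fin n))) (X : Ω → EuclideanSpace ℝ (Fin n)) : ℝ :=
  ⨅ u : E, μ.real {ω | ξ ≤ |inner ℝ (X ω) (u : EuclideanSpace ℝ (Fin n))|}

/-- The law of a Rademacher variable: `1` or `-1` with probability `1/2` each. -/
def rademacher : Measure ℝ :=
  (2⁻¹ : ℝ≥0∞) • Measure.dirac 1 + (2⁻¹ : ℝ≥0∞) • Measure.dirac (-1)

/-- The law of a Rademacher sequence of length `N`. -/
def rademacherSeq (N : ℕ) : Measure (Fin N → ℝ) :=
  Measure.pi fun _ => rademacher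

/-- `h = N^{-1/2} ∑_k ε_k b_k`, where `b_1, …, b_N` are the rows of `B`. -/
def h {N n : ℕ} (B : Matrix (Fin N) (Fin n) ℝ) (ε : Fin N → ℝ) : EuclideanSpace ℝ (Fin n) :=
  (√(N : ℝ))⁻¹ • ∑ k, ε k • row B k

/-- `sup_{u ∈ E} ⟨x, u⟩` in `[-∞, ∞]`. -/
def supInner {n : ℕ} (E : Set (EuclideanSpace ℝ (Fin n))) (x : EuclideanSpace ℝ (Fin n)) : EReal :=
  ⨆ u ∈ E, ((inner ℝ x u : ℝ) : EReal)

/-- `W_N(E, b) = E[sup_{u ∈ E} ⟨h, u⟩]` for a random matrix `B` with rows `b_1, …, b_N`. The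
Rademacher sequence is independent of `B`, hence the product measure. -/
def W {Ω : Type*} [MeasurableSpace Ω] {N n : ℕ} (μ : Measure Ω)
    (E : Set (EuclideanSpace ℝ (Fin n))) (B : Ω → Matrix (Fin N) (Fin n) ℝ) : EReal :=
  expectation (μ.prod (rademacherSeq N)) fun p => supInner E (h (B p.1) p.2)

/-- The expectation defining `W` exists in `[-∞, ∞]`. -/
def WExists {Ω : Type*} [MeasurableSpace Ω] {N n : ℕ} (μ : Measure Ω)
    (E : Set (EuclideanSpace ℝ (Fin n))) (B : Ω → Matrix (Fin N) (Fin n) ℝ) : Prop :=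
  ExpectationExists (μ.prod (rademacherSeq N)) fun p => supInner E (h (B p.1) p.2)

end SmallBall

end

open scoped NNReal

/-!
Pairing the rows leaves `N = ⌊m/2⌋` independent copies of the symmetric vector `b`, and
`(x - y) ^ 2 / 2 ≤ x ^ 2 + y ^ 2` shows that this decreases `‖A v‖`. By Cauchy–Schwarz it is then
enough to bound the empirical process `∑ i, |⟨b_i, v⟩|` from below. It dominates
`ξ * ∑ i, ramp ξ ⟨b_i, v⟩`, where the ramp is at most `1`, is `1 / ξ`-Lipschitz and has mean at
least `Q_{2ξ}`. The largest deviation of this sum below its mean over `v ∈ E` concentrates by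
McDiarmid's inequality, which gives the term `ξ t`. Its expectation is at most twice a Rademacher
complexity by symmetrization, and the contraction principle replaces the ramp by the linear
functionals at the cost of the factor `1 / ξ`; what is left is `W_N`. All suprema are taken over
finite families; a countable dense subset of `E` is exhausted by them.
-/

namespace SmallBall

section Product

variable {N : ℕ} {X : Fin (N + 1) → Type*} [∀ i, MeasurableSpace (X i)]
  (ν : ∀ i, Measure (X i)) [∀ i, SigmaFinite (ν i)]

theorem coe_piFinSuccAbove_zero_symm :
    ⇑(MeasurableEquiv.piFinSuccAbove X 0).symm =
      fun p : X 0 × (∀ i : Fin N, X i.succ) => (Fin.cons p.1 p.2 : ∀ i, X i) := by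
  ext p : 1
  exact Fin.insertNth_zero _ _

theorem measurableEmbedding_cons :
    MeasurableEmbedding
      fun p : X 0 × (∀ i : Fin N, X i.succ) => (Fin.cons p.1 p.2 : ∀ i, X i) := by
  rw [← coe_piFinSuccAbove_zero_symm]
  exact (MeasurableEquiv.piFinSuccAbove X 0).symm.measurableEmbedding

theorem measurePreserving_cons :
    MeasurePreserving (fun p : X 0 × (∀ i : Fin N, X i.succ) => (Fin.cons p.1 p.2 : ∀ i, X i))
      ((ν 0).prod (Measure.pi fun i => ν i.succ)) (Measure.pi ν) := by
  rw [← coe_piFinSuccAbove_zero_symm]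
  exact (measurePreserving_piFinSuccAbove ν 0).symm

theorem integral_pi_succ (f : (∀ i, X i) → ℝ) :
    ∫ x, f x ∂Measure.pi ν =
      ∫ p, f (Fin.cons p.1 p.2) ∂(ν 0).prod (Measure.pi fun i => ν i.succ) :=
  ((measurePreserving_cons ν).integral_comp measurableEmbedding_cons f).symm

theorem integrable_pi_succ_iff {f : (∀ i, X i) → ℝ} :
    Integrable f (Measure.pi ν) ↔
      Integrable (fun p : X 0 × (∀ i : Fin N, X i.succ) => f (Fin.cons p.1 p.2))
        ((ν 0).prod (Measure.pi fun i => ν i.succ)) :=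
  ((measurePreserving_cons ν).integrable_comp_emb measurableEmbedding_cons).symm

end Product

section BoundedDifferences

variable {ι : Type*} [DecidableEq ι]

/-- The bounded differences condition of McDiarmid's inequality: changing the `i`-th variable
alone changes the value of `f` by at most `c i`. -/
def HasBoundedDifferences {X : ι → Type*} (f : (∀ i, X i) → ℝ) (c : ι → ℝ≥0) : Prop :=
  ∀ x i y, |f (Function.update x i y) - f x| ≤ c i

theorem HasBoundedDifferences.abs_sub_le [Fintype ι] {X : ι → Type*} {f : (∀ i, X i) → ℝ}
    {c : ι → ℝ≥0} (hf : HasBoundedDifferences f c) (x y : ∀ i, X i) :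
    |f x - f y| ≤ ∑ i, (c i : ℝ) := by
  suffices ∀ s : Finset ι, |f (s.piecewise x y) - f y| ≤ ∑ i ∈ s, (c i : ℝ) by
    simpa using this Finset.univ
  intro s
  induction s using Finset.induction_on with
  | empty => simp
  | insert i s hi ih =>
    rw [Finset.piecewise_insert, Finset.sum_insert hi]
    exact (_root_.abs_sub_le _ _ _).trans (add_le_add (hf _ i (x i)) ih)

theorem HasBoundedDifferences.cons {N : ℕ} {X : Fin (N + 1) → Type*} {f : (∀ i, X i) → ℝ}
    {c : Fin (N + 1) → ℝ≥0} (hf : HasBoundedDifferences f c) (x : X 0) :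
    HasBoundedDifferences (fun y : ∀ i : Fin N, X i.succ => f (Fin.cons x y))
      fun i => c i.succ := fun y i z => by
  simpa only [Fin.cons_update] using hf (Fin.cons x y) i.succ z

theorem HasBoundedDifferences.integrable [Fintype ι] {X : ι → Type*}
    [∀ i, MeasurableSpace (X i)] {ν : ∀ i, Measure (X i)} [∀ i, IsProbabilityMeasure (ν i)]
    {f : (∀ i, X i) → ℝ} {c : ι → ℝ≥0} (hf : HasBoundedDifferences f c) (hm : Measurable f) :
    Integrable f (Measure.pi ν) := by
  obtain ⟨x₀⟩ := nonempty_of_isProbabilityMeasure (Measure.pi ν)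
  refine Integrable.of_bound hm.aestronglyMeasurable (|f x₀| + ∑ i, (c i : ℝ))
    (.of_forall fun x => ?_)
  calc ‖f x‖ = |f x₀ + (f x - f x₀)| := by rw [add_sub_cancel, Real.norm_eq_abs]
    _ ≤ |f x₀| + |f x - f x₀| := abs_add_le _ _
    _ ≤ |f x₀| + ∑ i, (c i : ℝ) := by gcongr; exact hf.abs_sub_le x x₀

/-- Hoeffding's lemma. -/
theorem hasSubgaussianMGF_sub_integral {X : Type*} [MeasurableSpace X] {ν : Measure X}
    [IsProbabilityMeasure ν] {g : X → ℝ} (hg : Measurable g) {r : ℝ≥0}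
    (hr : ∀ x y, |g x - g y| ≤ r) :
    HasSubgaussianMGF (fun x => g x - ∫ y, g y ∂ν) ((r / 2) ^ 2) ν := by
  obtain ⟨x₀⟩ := nonempty_of_isProbabilityMeasure ν
  have hle : ∀ x y, g x - r ≤ g y := fun x y => by linarith [abs_le.1 (hr x y)]
  have hbdd : BddBelow (Set.range g) := ⟨g x₀ - r, by rintro _ ⟨y, rfl⟩; exact hle x₀ y⟩
  have : Nonempty X := ⟨x₀⟩
  have hIcc : ∀ x, g x ∈ Set.Icc (⨅ y, g y) ((⨅ y, g y) + r) := fun x =>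
    ⟨ciInf_le hbdd x, by linarith [le_ciInf (hle x)]⟩
  simpa using hasSubgaussianMGF_of_mem_Icc (μ := ν) hg.aemeasurable (.of_forall hIcc)

theorem hasSubgaussianMGF_prod {X Y : Type*} [MeasurableSpace X] [MeasurableSpace Y]
    {ν : Measure X} [SFinite ν] {κ : Measure Y} [SFinite κ] {g : X → ℝ} {F : X → Y → ℝ}
    {c d : ℝ≥0} (hg : HasSubgaussianMGF g c ν) (hFm : Measurable (Function.uncurry F))
    (hF : ∀ x, HasSubgaussianMGF (F x) d κ) :
    HasSubgaussianMGF (fun p => g p.1 + F p.1 p.2) (c + d) (ν.prod κ) := by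
  have hexp : ∀ s x y, Real.exp (s * (g x + F x y)) = Real.exp (s * g x) * Real.exp (s * F x y) :=
    fun s x y => by rw [mul_add, Real.exp_add]
  have hsec : ∀ s x, ∫ y, Real.exp (s * (g x + F x y)) ∂κ ≤
      Real.exp (s * g x) * Real.exp (d * s ^ 2 / 2) := fun s x => by
    simp only [hexp, integral_const_mul]
    gcongr
    exact (hF x).mgf_le s
  have hint : ∀ s, Integrable (fun p => Real.exp (s * (g p.1 + F p.1 p.2))) (ν.prod κ) := by
    intro s
    have hgm : AEMeasurable (fun p : X × Y => g p.1) (ν.prod κ) := hg.aemeasurable.comp_fst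
    have hmeas : AEStronglyMeasurable (fun p => Real.exp (s * (g p.1 + F p.1 p.2))) (ν.prod κ) :=
      (Real.measurable_exp.comp_aemeasurable
        ((hgm.add hFm.aemeasurable).const_mul s)).aestronglyMeasurable
    refine (integrable_prod_iff hmeas).2 ⟨.of_forall fun x => ?_, ?_⟩
    · simpa only [hexp] using ((hF x).integrable_exp_mul s).const_mul _
    · refine ((hg.integrable_exp_mul s).mul_const (Real.exp (d * s ^ 2 / 2))).mono'
        hmeas.norm.integral_prod_right' (.of_forall fun x => ?_)
      simp only [Real.norm_eq_abs, Real.abs_exp]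
      rw [abs_of_nonneg (by positivity)]
      exact hsec s x
  refine ⟨hint, fun s => ?_⟩
  calc mgf (fun p => g p.1 + F p.1 p.2) (ν.prod κ) s
      = ∫ x, ∫ y, Real.exp (s * (g x + F x y)) ∂κ ∂ν := integral_prod _ (hint s)
    _ ≤ ∫ x, Real.exp (s * g x) * Real.exp (d * s ^ 2 / 2) ∂ν :=
        integral_mono (hint s).integral_prod_left ((hg.integrable_exp_mul s).mul_const _) (hsec s)
    _ ≤ Real.exp (c * s ^ 2 / 2) * Real.exp (d * s ^ 2 / 2) := by
        rw [integral_mul_const]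
        gcongr
        exact hg.mgf_le s
    _ = Real.exp ((c + d : ℝ≥0) * s ^ 2 / 2) := by
        rw [← Real.exp_add, NNReal.coe_add]
        ring_nf

/-- McDiarmid's inequality, in sub-Gaussian form. -/
theorem HasBoundedDifferences.hasSubgaussianMGF {N : ℕ} {X : Fin N → Type*}
    [∀ i, MeasurableSpace (X i)] (ν : ∀ i, Measure (X i)) [∀ i, IsProbabilityMeasure (ν i)]
    {f : (∀ i, X i) → ℝ} {c : Fin N → ℝ≥0} (hf : HasBoundedDifferences f c) (hm : Measurable f) :
    HasSubgaussianMGF (fun x => f x - ∫ y, f y ∂Measure.pi ν) (∑ i, (c i / 2) ^ 2)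
      (Measure.pi ν) := by
  induction N with
  | zero =>
    have hconst : ∀ x, f x = f default := fun x => congrArg f (Subsingleton.elim _ _)
    simp [hconst]
  | succ N ih =>
    let P : Measure (∀ i : Fin N, X i.succ) := Measure.pi fun i => ν i.succ
    let g : X 0 → ℝ := fun x => ∫ y, f (Fin.cons x y) ∂P
    have hcons : Measurable (Function.uncurry fun (x : X 0) (y : ∀ i : Fin N, X i.succ) =>
        f (Fin.cons x y)) :=
      hm.comp measurableEmbedding_cons.measurable
    have hint : ∀ x, Integrable (fun y => f (Fin.cons x y)) P := fun x =>
      (hf.cons x).integrable (hcons.comp measurable_prodMk_left)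
    have hg : Measurable g := hcons.stronglyMeasurable.integral_prod_right.measurable
    have hgd : ∀ x x', |g x - g x'| ≤ c 0 := fun x x' => by
      have hle : ∀ y, ‖f (Fin.cons x y) - f (Fin.cons x' y)‖ ≤ c 0 := fun y => by
        simpa only [Fin.update_cons_zero, Real.norm_eq_abs] using hf (Fin.cons x' y) 0 x
      rw [← integral_sub (hint x) (hint x')]
      simpa using norm_integral_le_of_norm_le_const (μ := P) (.of_forall hle)
    have hmean : ∫ x, f x ∂Measure.pi ν = ∫ x, g x ∂ν 0 := by
      rw [integral_pi_succ, integral_prod]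
      exact (integrable_pi_succ_iff ν).1 (hf.integrable hm)
    have hsum := hasSubgaussianMGF_prod (hasSubgaussianMGF_sub_integral (ν := ν 0) hg hgd)
      (F := fun x y => f (Fin.cons x y) - g x) (hcons.sub (hg.comp measurable_fst))
      fun x => ih (fun i => ν i.succ) (hf.cons x) (hcons.comp measurable_prodMk_left)
    rw [Fin.sum_univ_succ, hmean]
    refine hsum.congr_identDistrib ⟨hsum.aemeasurable, (hm.sub_const _).aemeasurable, ?_⟩
    rw [← (measurePreserving_cons ν).map_eq, Measure.map_map (hm.sub_const _)
      measurableEmbedding_cons.measurable]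
    congr 1 with p
    simp

theorem HasBoundedDifferences.one_sub_exp_le_measureReal {N : ℕ} {X : Fin N → Type*}
    [∀ i, MeasurableSpace (X i)] (ν : ∀ i, Measure (X i)) [∀ i, IsProbabilityMeasure (ν i)]
    {f : (∀ i, X i) → ℝ} {c : Fin N → ℝ≥0} (hf : HasBoundedDifferences f c) (hm : Measurable f)
    {s : ℝ} (hs : 0 ≤ s) :
    1 - Real.exp (-2 * s ^ 2 / ∑ i, (c i : ℝ) ^ 2) ≤
      (Measure.pi ν).real {x | f x < ∫ y, f y ∂Measure.pi ν + s} := by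
  have hcompl : {x | f x < ∫ y, f y ∂Measure.pi ν + s} =
      {x | s ≤ f x - ∫ y, f y ∂Measure.pi ν}ᶜ := by
    ext x
    simp [sub_lt_iff_lt_add']
  have hexp : -s ^ 2 / (2 * ((∑ i, (c i / 2) ^ 2 : ℝ≥0) : ℝ)) =
      -2 * s ^ 2 / ∑ i, (c i : ℝ) ^ 2 := by
    push_cast
    simp only [div_pow, ← Finset.sum_div]
    field_simp
  rw [hcompl, ← hexp,
    probReal_compl_eq_one_sub (measurableSet_le measurable_const (hm.sub_const _))]
  gcongr
  exact (hf.hasSubgaussianMGF ν hm).measure_ge_le hs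

end BoundedDifferences

section BoundedDifferencesSup

variable {ι : Type*} [DecidableEq ι] {X : ι → Type*} {c : ι → ℝ≥0}

theorem hasBoundedDifferences_sum [Fintype ι] {φ : ∀ i, X i → ℝ}
    (hφ : ∀ i x y, |φ i x - φ i y| ≤ c i) :
    HasBoundedDifferences (fun x => ∑ i, φ i (x i)) c := fun x i y => by
  have hsum : ∑ j, φ j (Function.update x i y j) - ∑ j, φ j (x j) = φ i y - φ i (x i) := by
    rw [← Finset.sum_sub_distrib, Finset.sum_eq_single i]
    · rw [Function.update_self]
    · exact fun j _ hj => by rw [Function.update_of_ne hj, sub_self]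
    · simp
  rw [hsum]
  exact hφ i y (x i)

theorem HasBoundedDifferences.iSup {κ : Type*} [Finite κ] [Nonempty κ]
    {F : κ → (∀ i, X i) → ℝ} (hF : ∀ u, HasBoundedDifferences (F u) c) :
    HasBoundedDifferences (fun x => ⨆ u, F u x) c := fun x i y => by
  have hle : ∀ x' x'', (∀ u, |F u x' - F u x''| ≤ c i) → ⨆ u, F u x' ≤ (⨆ u, F u x'') + c i :=
    fun x' x'' h => ciSup_le fun u => by
      linarith [abs_le.1 (h u), le_ciSup (Set.finite_range fun u => F u x'').bddAbove u]
  have hupper := hle (Function.update x i y) x fun u => hF u x i y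
  have hlower := hle x (Function.update x i y) fun u => by rw [abs_sub_comm]; exact hF u x i y
  exact abs_le.2 ⟨by linarith, by linarith⟩

end BoundedDifferencesSup

section FiniteSup

variable {ι Ω : Type*} [Finite ι] [Nonempty ι] [MeasurableSpace Ω] {μ : Measure Ω}

theorem iSup_add_iSup_le {c d : ι → ℝ} {r : ℝ} (h : ∀ u v, c u + d v ≤ r) :
    (⨆ u, c u) + ⨆ v, d v ≤ r := by
  obtain ⟨u, hu⟩ := exists_eq_ciSup_of_finite (f := c)
  obtain ⟨v, hv⟩ := exists_eq_ciSup_of_finite (f := d)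
  rw [← hu, ← hv]
  exact h u v

theorem integrable_iSup {f : ι → Ω → ℝ} (hf : ∀ u, Integrable (f u) μ) :
    Integrable (fun ω => ⨆ u, f u ω) μ := by
  cases nonempty_fintype ι
  refine (integrable_finsetSum Finset.univ fun u _ => (hf u).norm).mono'
    (AEMeasurable.iSup fun u => (hf u).aemeasurable).aestronglyMeasurable (.of_forall fun ω => ?_)
  obtain ⟨u, hu⟩ := exists_eq_ciSup_of_finite (f := fun u => f u ω)
  rw [← hu]
  exact Finset.single_le_sum (f := fun u => ‖f u ω‖) (fun _ _ => norm_nonneg _) (Finset.mem_univ u)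

-- The coordinates are exchanged one at a time; the arbitrary shift `c` absorbs the others.
theorem integral_iSup_sum_le {X Y : Type*} [MeasurableSpace X] [MeasurableSpace Y]
    {ν : Measure X} [IsProbabilityMeasure ν] {κ : Measure Y} [IsProbabilityMeasure κ]
    {φ : ι → X → ℝ} {g : ι → Y → ℝ} (hφ : ∀ u, Integrable (φ u) ν) (hg : ∀ u, Integrable (g u) κ)
    (h : ∀ c : ι → ℝ, ∫ x, ⨆ u, (c u + φ u x) ∂ν ≤ ∫ y, ⨆ u, (c u + g u y) ∂κ)
    (N : ℕ) (c : ι → ℝ) :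
    ∫ x, ⨆ u, (c u + ∑ i, φ u (x i)) ∂(Measure.pi fun _ : Fin N => ν) ≤
      ∫ y, ⨆ u, (c u + ∑ i, g u (y i)) ∂(Measure.pi fun _ : Fin N => κ) := by
  induction N generalizing c with
  | zero => simp
  | succ N ih =>
    let νN : Measure (Fin N → X) := Measure.pi fun _ => ν
    let κN : Measure (Fin N → Y) := Measure.pi fun _ => κ
    have hφs : ∀ u, Integrable (fun x => ∑ i, φ u (x i)) νN := fun u =>
      integrable_finsetSum _ fun i _ => integrable_comp_eval (hφ u)
    have hgs : ∀ u, Integrable (fun y => ∑ i, g u (y i)) κN := fun u =>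
      integrable_finsetSum _ fun i _ => integrable_comp_eval (hg u)
    have hφφ : Integrable (fun p => ⨆ u, (c u + (φ u p.1 + ∑ i, φ u (p.2 i)))) (ν.prod νN) :=
      integrable_iSup fun u => (integrable_const _).add <|
        ((hφ u).comp_fst _).add ((hφs u).comp_snd _)
    have hφg : Integrable (fun p => ⨆ u, (c u + (φ u p.1 + ∑ i, g u (p.2 i)))) (ν.prod κN) :=
      integrable_iSup fun u => (integrable_const _).add <|
        ((hφ u).comp_fst _).add ((hgs u).comp_snd _)
    have hgg : Integrable (fun p => ⨆ u, (c u + (g u p.1 + ∑ i, g u (p.2 i)))) (κ.prod κN) :=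
      integrable_iSup fun u => (integrable_const _).add <|
        ((hg u).comp_fst _).add ((hgs u).comp_snd _)
    rw [integral_pi_succ, integral_pi_succ]
    simp only [Fin.sum_univ_succ, Fin.cons_zero, Fin.cons_succ]
    calc _ = ∫ x, ∫ x', ⨆ u, (c u + (φ u x + ∑ i, φ u (x' i))) ∂νN ∂ν := integral_prod _ hφφ
      _ ≤ ∫ x, ∫ y', ⨆ u, (c u + (φ u x + ∑ i, g u (y' i))) ∂κN ∂ν := by
        refine integral_mono hφφ.integral_prod_left hφg.integral_prod_left fun x => ?_
        simpa only [add_assoc] using ih fun u => c u + φ u x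
      _ = ∫ y', ∫ x, ⨆ u, (c u + (φ u x + ∑ i, g u (y' i))) ∂ν ∂κN :=
        integral_integral_swap hφg
      _ ≤ ∫ y', ∫ y, ⨆ u, (c u + (g u y + ∑ i, g u (y' i))) ∂κ ∂κN := by
        refine integral_mono hφg.integral_prod_right hgg.integral_prod_right fun y' => ?_
        simpa only [add_assoc, add_comm (∑ i, g _ (y' i))] using h fun u => c u + ∑ i, g u (y' i)
      _ = _ := (integral_prod_symm _ hgg).symm

end FiniteSup

section Rademacher

instance : IsProbabilityMeasure rademacher :=
  ⟨by simp [rademacher, ENNReal.inv_two_add_inv_two]⟩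

theorem integrable_rademacher (f : ℝ → ℝ) : Integrable f rademacher :=
  ((integrable_dirac (by simp)).smul_measure (by simp)).add_measure
    ((integrable_dirac (by simp)).smul_measure (by simp))

theorem integral_rademacher (f : ℝ → ℝ) :
    ∫ s, f s ∂rademacher = 2⁻¹ * (f 1 + f (-1)) := by
  have h := integrable_rademacher f
  rw [rademacher, integrable_add_measure] at h
  rw [rademacher, integral_add_measure h.1 h.2, integral_smul_measure, integral_smul_measure,
    integral_dirac, integral_dirac]
  simp [mul_add]

theorem measurePreserving_neg_rademacher :
    MeasurePreserving (fun s : ℝ => -s) rademacher rademacher := by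
  refine ⟨measurable_neg, ?_⟩
  rw [rademacher, Measure.map_add _ _ measurable_neg, Measure.map_smul, Measure.map_smul,
    Measure.map_dirac' measurable_neg, Measure.map_dirac' measurable_neg, neg_neg, add_comm]

variable {X : Type*} [MeasurableSpace X] {ν : Measure X} [IsProbabilityMeasure ν]

theorem integral_prod_rademacher {F : X × ℝ → ℝ} (hF : Integrable F (ν.prod rademacher)) :
    ∫ p, F p ∂(ν.prod rademacher) = ∫ x, 2⁻¹ * (F (x, 1) + F (x, -1)) ∂ν := by
  rw [integral_prod _ hF]
  simp only [integral_rademacher]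

theorem ae_rademacher_ne_zero : ∀ᵐ s ∂rademacher, s ≠ 0 := by
  rw [rademacher, ae_add_measure_iff]
  exact ⟨Measure.ae_smul_measure ((ae_dirac_iff (by measurability)).2 (by norm_num)) _,
    Measure.ae_smul_measure ((ae_dirac_iff (by measurability)).2 (by norm_num)) _⟩

theorem integrable_sign_mul_iff {f : X → ℝ} :
    Integrable (fun p : X × ℝ => p.2 * f p.1) (ν.prod rademacher) ↔ Integrable f ν := by
  refine ⟨fun h => ?_, fun h => ?_⟩
  · obtain ⟨s, hs, hs0⟩ := (h.prod_left_ae.and ae_rademacher_ne_zero).exists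
    exact (integrable_const_mul_iff hs0.isUnit f).1 hs
  · simpa only [mul_comm, id_eq] using h.mul_prod (integrable_rademacher id)

end Rademacher

theorem integrable_comp_of_lipschitzWith {α : Type*} [MeasurableSpace α] {μ : Measure α}
    [IsFiniteMeasure μ] {K : ℝ≥0} {φ : ℝ → ℝ} (hφ : LipschitzWith K φ) {g : α → ℝ}
    (hg : Integrable g μ) : Integrable (fun x => φ (g x)) μ := by
  refine ((integrable_const |φ 0|).add (hg.norm.const_mul K)).mono'
    (hφ.continuous.comp_aestronglyMeasurable hg.1) (.of_forall fun x => ?_)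
  have hdist : |φ (g x) - φ 0| ≤ K * |g x| := by
    simpa [Real.dist_eq] using hφ.dist_le_mul (g x) 0
  calc ‖φ (g x)‖ = |φ 0 + (φ (g x) - φ 0)| := by rw [add_sub_cancel, Real.norm_eq_abs]
    _ ≤ |φ 0| + |φ (g x) - φ 0| := abs_add_le _ _
    _ ≤ |φ 0| + K * ‖g x‖ := by gcongr; exact hdist

section RademacherComplexity

variable {ι : Type*} {X : Type*} [MeasurableSpace X]

/-- The expected supremum of the Rademacher sums of a class of functions over a sample of size
`N` from `ν`. There is no normalization by the sample size, and the signs are carried along with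
the sample points. -/
noncomputable def rademacherComplexity (ν : Measure X) (N : ℕ) (f : ι → X → ℝ) : ℝ :=
  ∫ p, ⨆ u, ∑ i, (p i).2 * f u (p i).1 ∂(Measure.pi fun _ : Fin N => ν.prod rademacher)

variable {ν : Measure X} {f : ι → X → ℝ}

theorem integral_iSup_sum_mul_sign (K : ℝ≥0) (N : ℕ) :
    ∫ p, ⨆ u, ∑ i, K * ((p i).2 * f u (p i).1) ∂(Measure.pi fun _ : Fin N => ν.prod rademacher) =
      K * rademacherComplexity ν N f := by
  simp only [rademacherComplexity, ← integral_const_mul, ← Finset.mul_sum,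
    Real.mul_iSup_of_nonneg K.coe_nonneg]

variable [Finite ι] [Nonempty ι] [IsProbabilityMeasure ν]

theorem integral_iSup_add_mul_sign (hf : ∀ u, Integrable (f u) ν) (c : ι → ℝ) (K : ℝ) :
    ∫ p, ⨆ u, (c u + K * (p.2 * f u p.1)) ∂(ν.prod rademacher) =
      ∫ x, 2⁻¹ * ((⨆ u, (c u + K * f u x)) + ⨆ u, (c u - K * f u x)) ∂ν := by
  have hint : Integrable (fun p : X × ℝ => ⨆ u, (c u + K * (p.2 * f u p.1)))
      (ν.prod rademacher) := integrable_iSup fun u =>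
    (integrable_const _).add ((integrable_sign_mul_iff.2 (hf u)).const_mul K)
  rw [integral_prod_rademacher hint]
  simp only [one_mul, neg_mul, mul_neg, ← sub_eq_add_neg]

theorem integral_iSup_add_centered_le (hf : ∀ u, Integrable (f u) ν) (c : ι → ℝ) :
    ∫ x, ⨆ u, (c u + (∫ y, f u y ∂ν - f u x)) ∂ν ≤
      ∫ p, ⨆ u, (c u + 2 * (p.2 * f u p.1)) ∂(ν.prod rademacher) := by
  have hplus : Integrable (fun x => ⨆ u, (c u + 2 * f u x)) ν :=
    integrable_iSup fun u => (integrable_const _).add ((hf u).const_mul 2)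
  have hminus : Integrable (fun x => ⨆ u, (c u - 2 * f u x)) ν :=
    integrable_iSup fun u => (integrable_const _).sub ((hf u).const_mul 2)
  have hjensen : ∀ u, c u + 2 * ∫ y, f u y ∂ν ≤ ∫ y, ⨆ u, (c u + 2 * f u y) ∂ν := fun u => by
    have hu : Integrable (fun y => 2 * f u y) ν := (hf u).const_mul 2
    have hle := integral_mono ((integrable_const (c u)).add hu) hplus
      fun y => le_ciSup (f := fun u => c u + 2 * f u y) (Set.finite_range _).bddAbove u
    simpa [integral_add, integral_const_mul, hu] using hle
  have hle : ∀ x, ⨆ u, (c u + (∫ y, f u y ∂ν - f u x)) ≤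
      2⁻¹ * ((∫ y, ⨆ u, (c u + 2 * f u y) ∂ν) + ⨆ u, (c u - 2 * f u x)) := fun x =>
    ciSup_le fun u => by
      linarith [hjensen u, le_ciSup (Set.finite_range fun u => c u - 2 * f u x).bddAbove u]
  calc ∫ x, ⨆ u, (c u + (∫ y, f u y ∂ν - f u x)) ∂ν
      ≤ ∫ x, 2⁻¹ * ((∫ y, ⨆ u, (c u + 2 * f u y) ∂ν) + ⨆ u, (c u - 2 * f u x)) ∂ν :=
        integral_mono (integrable_iSup fun u => (integrable_const _).add
          ((integrable_const _).sub (hf u))) (((integrable_const _).add hminus).const_mul _) hle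
    _ = ∫ x, 2⁻¹ * ((⨆ u, (c u + 2 * f u x)) + ⨆ u, (c u - 2 * f u x)) ∂ν := by
        rw [integral_const_mul, integral_const_mul, integral_add (integrable_const _) hminus,
          integral_add hplus hminus]
        simp
    _ = ∫ p, ⨆ u, (c u + 2 * (p.2 * f u p.1)) ∂(ν.prod rademacher) :=
        (integral_iSup_add_mul_sign hf c 2).symm

theorem integral_iSup_sum_centered_le (hf : ∀ u, Integrable (f u) ν) (N : ℕ) :
    ∫ x, ⨆ u, ∑ i, (∫ y, f u y ∂ν - f u (x i)) ∂(Measure.pi fun _ : Fin N => ν) ≤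
      2 * rademacherComplexity ν N f := by
  have hsum := integral_iSup_sum_le (fun u => (integrable_const _).sub (hf u))
    (fun u => (integrable_sign_mul_iff.2 (hf u)).const_mul 2)
    (integral_iSup_add_centered_le hf) N 0
  simp only [Pi.zero_apply, zero_add] at hsum
  exact hsum.trans_eq (integral_iSup_sum_mul_sign 2 N)

theorem iSup_add_lipschitz_add_iSup_sub_lipschitz_le {K : ℝ≥0} {φ : ℝ → ℝ}
    (hφ : LipschitzWith K φ) (c r : ι → ℝ) :
    (⨆ u, (c u + φ (r u))) + (⨆ u, (c u - φ (r u))) ≤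
      (⨆ u, (c u + K * r u)) + ⨆ u, (c u - K * r u) := by
  refine iSup_add_iSup_le fun u v => ?_
  have hplus := le_ciSup (Set.finite_range fun u => c u + K * r u).bddAbove
  have hminus := le_ciSup (Set.finite_range fun u => c u - K * r u).bddAbove
  have hK : φ (r u) - φ (r v) ≤ |K * r u - K * r v| := by
    rw [← mul_sub, abs_mul, NNReal.abs_eq]
    exact (le_abs_self _).trans (hφ.dist_le_mul _ _)
  rcases abs_cases (K * r u - K * r v) with ⟨habs, -⟩ | ⟨habs, -⟩
  · linarith [hplus u, hminus v]
  · linarith [hplus v, hminus u]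

/-- The Ledoux–Talagrand contraction principle. -/
theorem rademacherComplexity_lipschitz_comp_le {K : ℝ≥0} {φ : ℝ → ℝ} (hφ : LipschitzWith K φ)
    (hf : ∀ u, Integrable (f u) ν) (N : ℕ) :
    rademacherComplexity ν N (fun u x => φ (f u x)) ≤ K * rademacherComplexity ν N f := by
  have hφf : ∀ u, Integrable (fun x => φ (f u x)) ν := fun u =>
    integrable_comp_of_lipschitzWith hφ (hf u)
  have hstep : ∀ c : ι → ℝ, ∫ p, ⨆ u, (c u + p.2 * φ (f u p.1)) ∂(ν.prod rademacher) ≤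
      ∫ p, ⨆ u, (c u + K * (p.2 * f u p.1)) ∂(ν.prod rademacher) := fun c => by
    have hφc := integral_iSup_add_mul_sign hφf c 1
    simp only [one_mul] at hφc
    rw [hφc, integral_iSup_add_mul_sign hf]
    refine integral_mono ?_ ?_ fun x => by
      have := iSup_add_lipschitz_add_iSup_sub_lipschitz_le hφ c fun u => f u x
      gcongr
    · exact ((integrable_iSup fun u => (integrable_const _).add (hφf u)).add
        (integrable_iSup fun u => (integrable_const _).sub (hφf u))).const_mul _
    · exact ((integrable_iSup fun u => (integrable_const _).add ((hf u).const_mul _)).add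
        (integrable_iSup fun u => (integrable_const _).sub ((hf u).const_mul _))).const_mul _
  have hsum := integral_iSup_sum_le (fun u => integrable_sign_mul_iff.2 (hφf u))
    (fun u => (integrable_sign_mul_iff.2 (hf u)).const_mul K) hstep N 0
  simp only [Pi.zero_apply, zero_add, integral_iSup_sum_mul_sign] at hsum
  exact hsum

end RademacherComplexity

section UniformDeviation

variable {ι : Type*} [Finite ι] [Nonempty ι] {X : Type*} [MeasurableSpace X] {ν : Measure X}
  [IsProbabilityMeasure ν]

theorem one_sub_exp_le_measureReal_forall_sum_ge {g : ι → X → ℝ} (hg : ∀ u, Measurable (g u))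
    (hg01 : ∀ u x, g u x ∈ Set.Icc (0 : ℝ) 1) (N : ℕ) {s : ℝ} (hs : 0 ≤ s) :
    1 - Real.exp (-2 * s ^ 2 / N) ≤ (Measure.pi fun _ : Fin N => ν).real
      {x | ∀ u, N * ∫ y, g u y ∂ν - (2 * rademacherComplexity ν N g + s) ≤ ∑ i, g u (x i)} := by
  let T : (Fin N → X) → ℝ := fun x => ⨆ u, ∑ i, (∫ y, g u y ∂ν - g u (x i))
  have hT : Measurable T := Measurable.iSup fun u => by fun_prop
  have hφ : ∀ u x y, |(∫ z, g u z ∂ν - g u x) - (∫ z, g u z ∂ν - g u y)| ≤ (1 : ℝ≥0) :=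
    fun u x y => by
      rw [sub_sub_sub_cancel_left]
      exact abs_sub_le_of_nonneg_of_le (hg01 u y).1 (hg01 u y).2 (hg01 u x).1 (hg01 u x).2
  have hTd : HasBoundedDifferences T fun _ => 1 :=
    .iSup fun u => hasBoundedDifferences_sum fun _ => hφ u
  have hgi : ∀ u, Integrable (g u) ν := fun u =>
    Integrable.of_mem_Icc 0 1 (hg u).aemeasurable (.of_forall (hg01 u))
  have hmean : ∫ x, T x ∂(Measure.pi fun _ => ν) ≤ 2 * rademacherComplexity ν N g :=
    integral_iSup_sum_centered_le hgi N
  have htail := hTd.one_sub_exp_le_measureReal (fun _ => ν) hT hs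
  simp only [NNReal.coe_one, one_pow, Finset.sum_const, Finset.card_univ, Fintype.card_fin,
    nsmul_eq_mul, mul_one] at htail
  refine htail.trans (measureReal_mono fun x hx u => ?_)
  have hu : ∑ i, (∫ y, g u y ∂ν - g u (x i)) ≤ T x :=
    le_ciSup (f := fun u => ∑ i, (∫ y, g u y ∂ν - g u (x i))) (Set.finite_range _).bddAbove u
  rw [Finset.sum_sub_distrib, Finset.sum_const, Finset.card_univ, Fintype.card_fin,
    nsmul_eq_mul] at hu
  have hx' : T x < ∫ y, T y ∂(Measure.pi fun _ => ν) + s := hx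
  linarith

end UniformDeviation

section Ramp

/-- The piecewise linear minorant of the indicator of `|s| ≥ 2 ξ` that vanishes for `|s| ≤ ξ` and
equals one for `|s| ≥ 2 ξ`; unlike the indicator it is Lipschitz. -/
noncomputable def ramp (ξ s : ℝ) : ℝ := max 0 (min 1 (|s| / ξ - 1))

variable {ξ : ℝ}

theorem ramp_mem_Icc (ξ s : ℝ) : ramp ξ s ∈ Set.Icc (0 : ℝ) 1 :=
  ⟨le_max_left _ _, max_le zero_le_one (min_le_left _ _)⟩

theorem mul_ramp_le_abs (hξ : 0 < ξ) (s : ℝ) : ξ * ramp ξ s ≤ |s| := by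
  rw [← le_div_iff₀' hξ]
  exact max_le (by positivity) ((min_le_right _ _).trans (by linarith))

theorem ramp_eq_one (hξ : 0 < ξ) {s : ℝ} (hs : 2 * ξ ≤ |s|) : ramp ξ s = 1 := by
  have : 2 ≤ |s| / ξ := by rwa [le_div_iff₀ hξ]
  rw [ramp, min_eq_left (by linarith), max_eq_right zero_le_one]

theorem lipschitzWith_ramp (hξ : 0 < ξ) : LipschitzWith ξ⁻¹.toNNReal (ramp ξ) := by
  have hlip : LipschitzWith ξ⁻¹.toNNReal fun s : ℝ => |s| / ξ - 1 :=
    .of_dist_le_mul fun s r => by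
      rw [Real.dist_eq, Real.dist_eq, Real.coe_toNNReal _ (inv_pos.2 hξ).le,
        sub_sub_sub_cancel_right, ← sub_div, abs_div, abs_of_pos hξ, div_eq_inv_mul]
      exact mul_le_mul_of_nonneg_left (abs_abs_sub_abs_le s r) (inv_pos.2 hξ).le
  exact (hlip.const_min 1).const_max 0

theorem measurable_ramp : Measurable (ramp ξ) := by
  unfold ramp
  fun_prop

theorem measureReal_le_integral_ramp {X : Type*} [MeasurableSpace X] {ν : Measure X}
    [IsFiniteMeasure ν] {f : X → ℝ} (hf : Measurable f) (hξ : 0 < ξ) :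
    ν.real {x | 2 * ξ ≤ |f x|} ≤ ∫ x, ramp ξ (f x) ∂ν := by
  have hmeas : MeasurableSet {x | 2 * ξ ≤ |f x|} := measurableSet_le measurable_const hf.abs
  have hint : Integrable (fun x => ramp ξ (f x)) ν :=
    Integrable.of_mem_Icc 0 1 (measurable_ramp.comp hf).aemeasurable
      (.of_forall fun x => ramp_mem_Icc ξ (f x))
  rw [← integral_indicator_one hmeas]
  refine integral_mono ((integrable_const (1 : ℝ)).indicator hmeas) hint
    (Set.indicator_le' (fun x hx => (ramp_eq_one hξ hx).ge) fun x _ => (ramp_mem_Icc ξ (f x)).1)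

end Ramp

/-- Mendelson's small ball method. -/
theorem one_sub_exp_le_measureReal_forall_sum_abs_ge {ι : Type*} [Finite ι] [Nonempty ι]
    {X : Type*} [MeasurableSpace X] {ν : Measure X} [IsProbabilityMeasure ν] {f : ι → X → ℝ}
    (hf : ∀ u, Measurable (f u)) (hfi : ∀ u, Integrable (f u) ν) (N : ℕ) {ξ q s : ℝ} (hξ : 0 < ξ)
    (hq : ∀ u, q ≤ ν.real {x | 2 * ξ ≤ |f u x|}) (hs : 0 ≤ s) :
    1 - Real.exp (-2 * s ^ 2 / N) ≤ (Measure.pi fun _ : Fin N => ν).real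
      {x | ∀ u, ξ * (N * q - s) - 2 * rademacherComplexity ν N f ≤ ∑ i, |f u (x i)|} := by
  refine (one_sub_exp_le_measureReal_forall_sum_ge (fun u => measurable_ramp.comp (hf u))
    (fun u x => ramp_mem_Icc ξ (f u x)) N hs).trans (measureReal_mono fun x hx u => ?_)
  have hcontr : ξ * rademacherComplexity ν N (fun u x => ramp ξ (f u x)) ≤
      rademacherComplexity ν N f := by
    rw [← le_inv_mul_iff₀ hξ, ← Real.coe_toNNReal _ (inv_pos.2 hξ).le]
    exact rademacherComplexity_lipschitz_comp_le (lipschitzWith_ramp hξ) hfi N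
  have hqu : N * q ≤ N * ∫ y, ramp ξ (f u y) ∂ν := by
    gcongr
    exact (hq u).trans (measureReal_le_integral_ramp (hf u) hξ)
  calc ξ * (N * q - s) - 2 * rademacherComplexity ν N f
      ≤ ξ * (N * ∫ y, ramp ξ (f u y) ∂ν -
          (2 * rademacherComplexity ν N (fun u x => ramp ξ (f u x)) + s)) := by
        nlinarith [mul_le_mul_of_nonneg_left hqu hξ.le]
    _ ≤ ξ * ∑ i, ramp ξ (f u (x i)) := mul_le_mul_of_nonneg_left (hx u) hξ.le
    _ ≤ ∑ i, |f u (x i)| := by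
        rw [Finset.mul_sum]
        exact Finset.sum_le_sum fun i _ => mul_ramp_le_abs hξ _

theorem one_sub_exp_le_measureReal_forall_sum_abs_ge_of_countable {ι : Type*} [Countable ι]
    {X : Type*} [MeasurableSpace X] {ν : Measure X} [IsProbabilityMeasure ν] {f : ι → X → ℝ}
    (hf : ∀ u, Measurable (f u)) (hfi : ∀ u, Integrable (f u) ν) (N : ℕ) {ξ q s R : ℝ} (hξ : 0 < ξ)
    (hq : ∀ u, q ≤ ν.real {x | 2 * ξ ≤ |f u x|}) (hs : 0 ≤ s)
    (hR : ∀ F : Finset ι, F.Nonempty → rademacherComplexity ν N (fun u : F => f u) ≤ R) :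
    1 - Real.exp (-2 * s ^ 2 / N) ≤ (Measure.pi fun _ : Fin N => ν).real
      {x | ∀ u, ξ * (N * q - s) - 2 * R ≤ ∑ i, |f u (x i)|} := by
  let S : Finset ι → Set (Fin N → X) := fun F =>
    {x | ∀ u ∈ F, ξ * (N * q - s) - 2 * R ≤ ∑ i, |f u (x i)|}
  have hSm : ∀ F, MeasurableSet (S F) := fun F => by
    simp only [S, Set.ofPred_forall]
    exact F.measurableSet_biInter fun u _ => measurableSet_le measurable_const (by fun_prop)
  have hS : ∀ F, 1 - Real.exp (-2 * s ^ 2 / N) ≤ (Measure.pi fun _ : Fin N => ν).real (S F) :=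
    fun F => by
      rcases F.eq_empty_or_nonempty with rfl | hF
      · simp [S, Real.exp_nonneg]
      have := hF.to_subtype
      refine (one_sub_exp_le_measureReal_forall_sum_abs_ge (f := fun u : F => f u)
        (fun u => hf u) (fun u => hfi u) N hξ (fun u => hq u) hs).trans
        (measureReal_mono fun x hx u hu => ?_)
      linarith [hx ⟨u, hu⟩, hR F hF]
  have hanti : Antitone S := fun F G hFG x hx u hu => hx u (hFG hu)
  have hlim := tendsto_measure_iInter_atTop (μ := Measure.pi fun _ : Fin N => ν)
    (fun F => (hSm F).nullMeasurableSet) hanti ⟨∅, measure_ne_top _ _⟩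
  have hInter : ⋂ F, S F = {x | ∀ u, ξ * (N * q - s) - 2 * R ≤ ∑ i, |f u (x i)|} := by
    ext x
    exact ⟨fun hx u => Set.mem_iInter.1 hx {u} u (Finset.mem_singleton_self u),
      fun hx => Set.mem_iInter.2 fun _ u _ => hx u⟩
  rw [hInter] at hlim
  exact ge_of_tendsto ((ENNReal.tendsto_toReal (measure_ne_top _ _)).comp hlim) (.of_forall hS)

section Expectation

variable {Ω : Type*} [MeasurableSpace Ω] {μ : Measure Ω} {f : Ω → ℝ}

theorem coe_integral_le_expectation {X : Ω → EReal} (hf : Integrable f μ)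
    (hle : ∀ ω, (f ω : EReal) ≤ X ω) : ((∫ ω, f ω ∂μ : ℝ) : EReal) ≤ expectation μ X := by
  have hpos : ∫⁻ ω, ENNReal.ofReal (f ω) ∂μ ≠ ∞ := hf.lintegral_lt_top.ne
  have hneg : ∫⁻ ω, ENNReal.ofReal (-f ω) ∂μ ≠ ∞ := hf.neg.lintegral_lt_top.ne
  rw [integral_eq_lintegral_pos_part_sub_lintegral_neg_part hf, EReal.coe_sub,
    EReal.coe_ennreal_toReal hpos, EReal.coe_ennreal_toReal hneg]
  exact EReal.sub_le_sub
    (EReal.coe_ennreal_le_coe_ennreal_iff.2 <|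
      lintegral_mono fun ω => EReal.toENNReal_le_toENNReal (hle ω))
    (EReal.coe_ennreal_le_coe_ennreal_iff.2 <|
      lintegral_mono fun ω => EReal.toENNReal_le_toENNReal (EReal.neg_le_neg_iff.2 (hle ω)))

theorem integrable_of_lintegral_ofReal_ne_top (hf : AEMeasurable f μ)
    (hpos : ∫⁻ ω, ENNReal.ofReal (f ω) ∂μ ≠ ∞) (hneg : ∫⁻ ω, ENNReal.ofReal (-f ω) ∂μ ≠ ∞) :
    Integrable f μ := by
  have habs : ∀ ω, ‖f ω‖ₑ = ENNReal.ofReal (f ω) + ENNReal.ofReal (-f ω) := fun ω => by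
    rw [Real.enorm_eq_ofReal_abs]
    rcases le_total 0 (f ω) with hω | hω
    · rw [abs_of_nonneg hω, ENNReal.ofReal_of_nonpos (neg_nonpos.2 hω), add_zero]
    · rw [abs_of_nonpos hω, ENNReal.ofReal_of_nonpos hω, zero_add]
  refine ⟨hf.aestronglyMeasurable, ?_⟩
  simp only [HasFiniteIntegral, habs, lintegral_add_left' hf.ennreal_ofReal]
  exact ENNReal.add_lt_top.2 ⟨hpos.lt_top, hneg.lt_top⟩

theorem integrable_of_integrable_sum {X : Type*} [MeasurableSpace X] {ν : Measure X}
    [IsProbabilityMeasure ν] {N : ℕ} (hN : N ≠ 0) {g : X → ℝ}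
    (hg : Integrable (fun x : Fin N → X => ∑ i, g (x i)) (Measure.pi fun _ => ν)) :
    Integrable g ν := by
  obtain ⟨N, rfl⟩ := Nat.exists_eq_succ_of_ne_zero hN
  have hcons := (integrable_pi_succ_iff fun _ => ν).1 hg
  simp only [Fin.sum_univ_succ, Fin.cons_zero, Fin.cons_succ] at hcons
  obtain ⟨y, hy⟩ := hcons.prod_left_ae.exists
  exact (integrable_add_iff_integrable_left' (integrable_const (∑ i, g (y i)))).1 hy

/-- Flipping all signs exchanges the positive and the negative part of the sum, so that bounding
the expectation of one of them is enough. -/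
theorem integrable_of_lintegral_ofReal_sum_mul_sign_ne_top {X : Type*} [MeasurableSpace X]
    {ν : Measure X} [IsProbabilityMeasure ν] {g : X → ℝ} (hg : Measurable g) {N : ℕ} (hN : N ≠ 0)
    (hsum : ∫⁻ p, ENNReal.ofReal (∑ i, (p i).2 * g (p i).1)
      ∂(Measure.pi fun _ : Fin N => ν.prod rademacher) ≠ ∞) :
    Integrable g ν := by
  have hmeas : Measurable fun p : Fin N → X × ℝ => ∑ i, (p i).2 * g (p i).1 := by fun_prop
  have hflip := measurePreserving_pi (fun _ : Fin N => ν.prod rademacher) _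
    fun _ => (MeasurePreserving.id ν).prod measurePreserving_neg_rademacher
  have hneg : ∫⁻ p, ENNReal.ofReal (-∑ i, (p i).2 * g (p i).1)
      ∂(Measure.pi fun _ : Fin N => ν.prod rademacher) ≠ ∞ := by
    rw [← hflip.lintegral_comp hmeas.ennreal_ofReal] at hsum
    simpa only [Prod.map_fst, Prod.map_snd, id_eq, neg_mul, Finset.sum_neg_distrib] using hsum
  exact integrable_sign_mul_iff.1 <| integrable_of_integrable_sum hN <|
    integrable_of_lintegral_ofReal_ne_top hmeas.aemeasurable hsum hneg

end Expectation

section HasLaw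

variable {α β γ δ : Type*} [MeasurableSpace α] [MeasurableSpace β] [MeasurableSpace γ]
  [MeasurableSpace δ]

theorem hasLaw_prodMap {μ : Measure α} {μ' : Measure β} {ν : Measure γ} {ν' : Measure δ}
    [IsProbabilityMeasure μ] [IsProbabilityMeasure μ'] {f : α → γ} {g : β → δ}
    (hf : HasLaw f ν μ) (hg : HasLaw g ν' μ') :
    HasLaw (Prod.map f g) (ν.prod ν') (μ.prod μ') :=
  (indepFun_prod₀ hf.aemeasurable hg.aemeasurable).hasLaw_prod
    (hf.comp measurePreserving_fst.hasLaw) (hg.comp measurePreserving_snd.hasLaw)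

theorem hasLaw_pi_prodMk {ι : Type*} [Fintype ι] {μ : Measure α} {Y : α → ι → γ}
    {Z : α → ι → δ} {ν : ι → Measure γ} {κ : ι → Measure δ} [∀ i, SigmaFinite (ν i)]
    [∀ i, SigmaFinite (κ i)]
    (h : HasLaw (fun ω => (Y ω, Z ω)) ((Measure.pi ν).prod (Measure.pi κ)) μ) :
    HasLaw (fun ω i => (Y ω i, Z ω i)) (Measure.pi fun i => (ν i).prod (κ i)) μ :=
  (measurePreserving_arrowProdEquivProdArrow γ δ ι ν κ).symm.comp_hasLaw h

theorem hasLaw_prod_rademacherSeq {μ : Measure α} [IsProbabilityMeasure μ] {ν : Measure γ}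
    [IsProbabilityMeasure ν] {N : ℕ} {Y : α → Fin N → γ}
    (hY : HasLaw Y (Measure.pi fun _ => ν) μ) :
    HasLaw (fun (p : α × (Fin N → ℝ)) i => (Y p.1 i, p.2 i))
      (Measure.pi fun _ => ν.prod rademacher) (μ.prod (rademacherSeq N)) := by
  unfold rademacherSeq
  exact hasLaw_pi_prodMk (hasLaw_prodMap hY .id)

theorem hasLaw_pi_prod_of_iIndepFun {ι : Type*} [Fintype ι] {μ : Measure α}
    [IsProbabilityMeasure μ] {Y : ι ⊕ ι → α → γ} {ν : ι ⊕ ι → Measure γ}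
    [∀ s, IsProbabilityMeasure (ν s)]
    (hindep : iIndepFun Y μ) (hY : ∀ s, HasLaw (Y s) (ν s) μ) :
    HasLaw (fun ω i => (Y (.inl i) ω, Y (.inr i) ω))
      (Measure.pi fun i => (ν (.inl i)).prod (ν (.inr i))) μ :=
  hasLaw_pi_prodMk ((measurePreserving_sumPiEquivProdPi ν).comp_hasLaw (hindep.hasLaw_pi hY))

end HasLaw

section Width

variable {N n : ℕ} {E : Set (EuclideanSpace ℝ (Fin n))}

theorem supInner_zero (hE : E.Nonempty) : supInner E 0 = 0 := by
  simp [supInner, biSup_const hE]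

theorem coe_inner_le_supInner (x : EuclideanSpace ℝ (Fin n)) {u : EuclideanSpace ℝ (Fin n)}
    (hu : u ∈ E) : ((inner ℝ x u : ℝ) : EReal) ≤ supInner E x :=
  le_iSup₂ (f := fun v (_ : v ∈ E) => ((inner ℝ x v : ℝ) : EReal)) u hu

theorem inner_h (B : Matrix (Fin N) (Fin n) ℝ) (ε : Fin N → ℝ) (u : EuclideanSpace ℝ (Fin n)) :
    inner ℝ (h B ε) u = (√(N : ℝ))⁻¹ * ∑ k, ε k * inner ℝ (row B k) u := by
  simp [h, real_inner_smul_left, sum_inner]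

variable {Ω : Type*} [MeasurableSpace Ω] {μ : Measure Ω} {B : Ω → Matrix (Fin N) (Fin n) ℝ}

theorem W_eq_zero (hN : N = 0) (hE : E.Nonempty) : W μ E B = 0 := by
  subst hN
  have hzero : ∀ p : Ω × (Fin 0 → ℝ), supInner E (h (B p.1) p.2) = 0 := fun p => by
    simp [h, supInner_zero hE]
  simp [W, expectation, hzero]

theorem lintegral_supInner_ne_top (hW : WExists μ E B) (hW' : W μ E B ≠ ⊤) :
    ∫⁻ p, (supInner E (h (B p.1) p.2)).toENNReal ∂(μ.prod (rademacherSeq N)) ≠ ∞ := by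
  intro htop
  have hneg := hW.resolve_left (not_not.2 htop)
  refine hW' ?_
  rw [W, expectation, htop, EReal.coe_ennreal_top]
  exact EReal.top_sub (by simpa using hneg)

variable [IsProbabilityMeasure μ] {ν : Measure (EuclideanSpace ℝ (Fin n))}
  [IsProbabilityMeasure ν]

theorem integrable_inner (hB : HasLaw (fun ω => row (B ω)) (Measure.pi fun _ => ν) μ)
    (hN : N ≠ 0) (hW : WExists μ E B) (hW' : W μ E B ≠ ⊤) {u : EuclideanSpace ℝ (Fin n)}
    (hu : u ∈ E) : Integrable (fun x => inner ℝ x u) ν := by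
  have hsum : Measurable fun p : Fin N → EuclideanSpace ℝ (Fin n) × ℝ =>
    ∑ i, (p i).2 * inner ℝ (p i).1 u := by fun_prop
  refine integrable_of_lintegral_ofReal_sum_mul_sign_ne_top (N := N) (by fun_prop) hN ?_
  rw [← (hasLaw_prod_rademacherSeq hB).lintegral_comp hsum.ennreal_ofReal.aemeasurable]
  have hle : ∀ p : Ω × (Fin N → ℝ),
      ENNReal.ofReal (∑ i, p.2 i * inner ℝ (row (B p.1) i) u) ≤
        ENNReal.ofReal √N * (supInner E (h (B p.1) p.2)).toENNReal := fun p => by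
    have hsN : √(N : ℝ) ≠ 0 := by positivity
    calc ENNReal.ofReal (∑ i, p.2 i * inner ℝ (row (B p.1) i) u)
        = ENNReal.ofReal √N * ENNReal.ofReal (inner ℝ (h (B p.1) p.2) u) := by
          rw [inner_h, ← ENNReal.ofReal_mul (Real.sqrt_nonneg _), mul_inv_cancel_left₀ hsN]
      _ ≤ ENNReal.ofReal √N * (supInner E (h (B p.1) p.2)).toENNReal := by
          gcongr
          rw [← EReal.real_coe_toENNReal]
          exact EReal.toENNReal_le_toENNReal (coe_inner_le_supInner _ hu)
  refine ne_top_of_le_ne_top ?_ (lintegral_mono hle)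
  rw [lintegral_const_mul' _ _ ENNReal.ofReal_ne_top]
  exact ENNReal.mul_ne_top ENNReal.ofReal_ne_top (lintegral_supInner_ne_top hW hW')

theorem rademacherComplexity_le_W (hB : HasLaw (fun ω => row (B ω)) (Measure.pi fun _ => ν) μ)
    {ι : Type*} [Finite ι] [Nonempty ι] {u : ι → EuclideanSpace ℝ (Fin n)} (hu : ∀ k, u k ∈ E)
    (hint : ∀ k, Integrable (fun x => inner ℝ x (u k)) ν) :
    (((√N)⁻¹ * rademacherComplexity ν N (fun k x => inner ℝ x (u k)) : ℝ) : EReal) ≤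
      W μ E B := by
  have hlaw := hasLaw_prod_rademacherSeq hB
  let M : (Fin N → EuclideanSpace ℝ (Fin n) × ℝ) → ℝ := fun p =>
    ⨆ k, ∑ i, (p i).2 * inner ℝ (p i).1 (u k)
  have hM : Integrable M (Measure.pi fun _ => ν.prod rademacher) :=
    integrable_iSup fun k => integrable_finsetSum _ fun i _ =>
      integrable_comp_eval (μ := fun _ : Fin N => ν.prod rademacher) (i := i)
        (integrable_sign_mul_iff.2 (hint k))
  have hMlaw : Integrable (fun p : Ω × (Fin N → ℝ) => M fun i => (row (B p.1) i, p.2 i))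
      (μ.prod (rademacherSeq N)) :=
    (hlaw.map_eq ▸ hM).comp_aemeasurable hlaw.aemeasurable
  have hle : ∀ p : Ω × (Fin N → ℝ), (((√N)⁻¹ * M fun i => (row (B p.1) i, p.2 i) : ℝ) : EReal) ≤
      supInner E (h (B p.1) p.2) := fun p => by
    obtain ⟨k, hk⟩ := exists_eq_ciSup_of_finite
      (f := fun k => ∑ i, p.2 i * inner ℝ (row (B p.1) i) (u k))
    simp only [M, ← hk, ← inner_h]
    exact coe_inner_le_supInner _ (hu k)
  calc (((√N)⁻¹ * rademacherComplexity ν N (fun k x => inner ℝ x (u k)) : ℝ) : EReal)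
      = ((∫ p, (√N)⁻¹ * M fun i => (row (B p.1) i, p.2 i) ∂(μ.prod (rademacherSeq N)) : ℝ) :
          EReal) := by
        rw [integral_const_mul, rademacherComplexity,
          ← hlaw.integral_comp hM.aestronglyMeasurable, Function.comp_def]
    _ ≤ W μ E B := coe_integral_le_expectation (hMlaw.const_mul _) hle

end Width

section SmallBallMethod

theorem toEuclideanLin_apply_eq_inner_row {m n : ℕ} (A : Matrix (Fin m) (Fin n) ℝ)
    (v : EuclideanSpace ℝ (Fin n)) (i : Fin m) :
    Matrix.toEuclideanLin A v i = inner ℝ (row A i) v := by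
  simp [Matrix.toLpLin_apply, Matrix.mulVec, dotProduct, row, PiLp.inner_apply, mul_comm]

theorem norm_toEuclideanLin_sq {m n : ℕ} (A : Matrix (Fin m) (Fin n) ℝ)
    (v : EuclideanSpace ℝ (Fin n)) :
    ‖Matrix.toEuclideanLin A v‖ ^ 2 = ∑ i, inner ℝ (row A i) v ^ 2 := by
  simp only [EuclideanSpace.norm_sq_eq, toEuclideanLin_apply_eq_inner_row, Real.norm_eq_abs,
    sq_abs]

theorem sum_abs_inner_row_le {m n : ℕ} (A : Matrix (Fin m) (Fin n) ℝ)
    (v : EuclideanSpace ℝ (Fin n)) :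
    ∑ i, |inner ℝ (row A i) v| ≤ √m * ‖Matrix.toEuclideanLin A v‖ := by
  refine abs_le_of_sq_le_sq' ?_ (by positivity) |>.2
  rw [mul_pow, Real.sq_sqrt m.cast_nonneg, norm_toEuclideanLin_sq]
  simpa only [sq_abs, Finset.card_univ, Fintype.card_fin] using
    sq_sum_le_card_mul_sum_sq (s := Finset.univ) (f := fun i => |inner ℝ (row A i) v|)

variable {Ω Ω₀ : Type*} [MeasurableSpace Ω] [MeasurableSpace Ω₀] {μ : Measure Ω} {μ₀ : Measure Ω₀}
  {N n : ℕ} {E : Set (EuclideanSpace ℝ (Fin n))} {ν : Measure (EuclideanSpace ℝ (Fin n))}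
  {B : Ω → Matrix (Fin N) (Fin n) ℝ} {b : Ω₀ → EuclideanSpace ℝ (Fin n)} {ξ t w : ℝ}

theorem Q_le_of_hasLaw (hb : HasLaw b ν μ₀) (ξ : ℝ) {u : EuclideanSpace ℝ (Fin n)} (hu : u ∈ E) :
    Q μ₀ ξ E b ≤ ν.real {x | ξ ≤ |inner ℝ x u|} := by
  rw [← hb.measureReal_eq (measurableSet_le measurable_const (by fun_prop))]
  exact ciInf_le (f := fun u : E => μ₀.real {ω | ξ ≤ |inner ℝ (b ω) u.1|})
    ⟨0, Set.forall_mem_range.2 fun _ => measureReal_nonneg⟩ ⟨u, hu⟩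

variable [IsProbabilityMeasure μ] [IsProbabilityMeasure ν]

theorem exists_coe_eq_W (hB : HasLaw (fun ω => row (B ω)) (Measure.pi fun _ => ν) μ)
    (hN : N ≠ 0) (hE : E.Nonempty) (hW : WExists μ E B) (hW' : W μ E B ≠ ⊤) :
    ∃ w : ℝ, (w : EReal) = W μ E B := by
  obtain ⟨u, hu⟩ := hE
  have hbot := rademacherComplexity_le_W hB (u := fun _ : Unit => u) (fun _ => hu)
    fun _ => integrable_inner hB hN hW hW' hu
  exact ⟨_, EReal.coe_toReal hW' (ne_bot_of_le_ne_bot (EReal.coe_ne_bot _) hbot)⟩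

theorem one_sub_exp_le_measureReal_forall_le_norm
    (hB : HasLaw (fun ω => row (B ω)) (Measure.pi fun _ => ν) μ) (hb : HasLaw b ν μ₀) (hN : N ≠ 0)
    (hint : ∀ u ∈ E, Integrable (fun x => inner ℝ x u) ν)
    (hw : W μ E B = w) (hξ : 0 < ξ) (ht : 0 ≤ t) :
    1 - Real.exp (-2 * t ^ 2) ≤ μ.real {ω | ∀ v ∈ E,
      ξ * √N * Q μ₀ (2 * ξ) E b - ξ * t - 2 * w ≤ ‖Matrix.toEuclideanLin (B ω) v‖} := by
  have hN' : (0 : ℝ) < N := by positivity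
  obtain ⟨D, hDc, hD⟩ := TopologicalSpace.exists_countable_dense E
  have : Countable D := hDc.to_subtype
  have hcomplexity : ∀ F : Finset D, F.Nonempty →
      rademacherComplexity ν N (fun (u : F) x => inner ℝ x (u : E).1) ≤ √N * w := fun F hF => by
    have := hF.to_subtype
    have hle := rademacherComplexity_le_W hB (u := fun u : F => (u : E).1) (fun u => u.1.1.2)
      fun u => hint _ u.1.1.2
    rwa [hw, EReal.coe_le_coe_iff, inv_mul_le_iff₀ (by positivity)] at hle
  have htail := one_sub_exp_le_measureReal_forall_sum_abs_ge_of_countable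
    (f := fun (u : D) x => inner ℝ x (u : E).1) (fun u => by fun_prop) (fun u => hint _ u.1.2) N hξ
    (fun u => Q_le_of_hasLaw hb (2 * ξ) u.1.2) (by positivity : 0 ≤ t * √N) hcomplexity
  have hexp : -2 * (t * √N) ^ 2 / N = -2 * t ^ 2 := by
    rw [mul_pow, Real.sq_sqrt hN'.le]
    field_simp
  rw [hexp, ← hB.measureReal_eq] at htail
  · refine htail.trans (measureReal_mono fun ω hω v hv => ?_)
    refine hD.denseRange_val.induction_on (p := fun v : E => _ ≤ ‖Matrix.toEuclideanLin (B ω) v‖)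
      ⟨v, hv⟩ (isClosed_le continuous_const ?_) fun u => ?_
    · exact ((Matrix.toEuclideanLin (B ω)).continuous_of_finiteDimensional.comp
        continuous_subtype_val).norm
    · have hu := (hω u).trans (sum_abs_inner_row_le (B ω) u.1)
      refine le_of_mul_le_mul_left ?_ (by positivity : 0 < √(N : ℝ))
      convert hu using 1
      linear_combination (ξ * Q μ₀ (2 * ξ) E b) * Real.mul_self_sqrt hN'.le
  · simp only [Set.ofPred_forall]
    exact MeasurableSet.iInter fun u => measurableSet_le measurable_const (by fun_prop)

theorem one_sub_exp_le_measureReal_le_iInf_norm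
    (hB : HasLaw (fun ω => row (B ω)) (Measure.pi fun _ => ν) μ) (hb : HasLaw b ν μ₀)
    (hW : WExists μ E B) (hξ : 0 < ξ) (ht : 0 ≤ t) :
    1 - Real.exp (-2 * t ^ 2) ≤ μ.real {ω |
      ((ξ * √N * Q μ₀ (2 * ξ) E b - ξ * t : ℝ) : EReal) - 2 * W μ E B ≤
        ⨅ v ∈ E, ((‖Matrix.toEuclideanLin (B ω) v‖ : ℝ) : EReal)} := by
  have htriv : ∀ {s : Set Ω}, (∀ ω, ω ∈ s) → 1 - Real.exp (-2 * t ^ 2) ≤ μ.real s := fun hs => by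
    rw [Set.eq_univ_of_forall hs, probReal_univ]
    linarith [Real.exp_nonneg (-2 * t ^ 2)]
  rcases E.eq_empty_or_nonempty with rfl | hE
  · exact htriv fun ω => by simp
  rcases eq_or_ne (W μ E B) ⊤ with htop | htop
  · exact htriv fun ω => by simp [htop, EReal.mul_top_of_pos, EReal.sub_top]
  rcases eq_or_ne N 0 with hN | hN
  · have hnonpos : ξ * √N * Q μ₀ (2 * ξ) E b - ξ * t ≤ 0 := by
      simpa [hN] using mul_nonneg hξ.le ht
    refine htriv fun ω => ?_
    rw [Set.mem_ofPred_eq, W_eq_zero hN hE, mul_zero, sub_zero]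
    exact le_iInf₂ fun v _ => EReal.coe_le_coe_iff.2 (hnonpos.trans (norm_nonneg _))
  obtain ⟨w, hw⟩ := exists_coe_eq_W hB hN hE hW htop
  refine (one_sub_exp_le_measureReal_forall_le_norm hB hb hN
    (fun u hu => integrable_inner hB hN hW htop hu) hw.symm hξ ht).trans
    (measureReal_mono fun ω hω => ?_)
  rw [Set.mem_ofPred_eq, ← hw]
  exact le_iInf₂ fun v hv => EReal.coe_le_coe_iff.2 (hω v hv)

end SmallBallMethod

section Debias

/-- The embedding of two copies of the indices `i < ⌊m/2⌋` as the even indices `2i` and the odd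
indices `2i + 1`; it presents the rows paired by `debias` as one independent family. -/
def pairIndex (m : ℕ) : Fin (m / 2) ⊕ Fin (m / 2) → Fin m :=
  Sum.elim (fun i => ⟨2 * i.1, by omega⟩) (fun i => ⟨2 * i.1 + 1, by omega⟩)

theorem pairIndex_injective (m : ℕ) : Function.Injective (pairIndex m) := by
  rintro (i | i) (j | j) hij <;>
    simp only [pairIndex, Sum.elim_inl, Sum.elim_inr, Fin.mk.injEq] at hij
  · exact congrArg Sum.inl (Fin.ext (by omega))
  · omega
  · omega
  · exact congrArg Sum.inr (Fin.ext (by omega))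

theorem row_debias {m n : ℕ} (A : Matrix (Fin m) (Fin n) ℝ) (i : Fin (m / 2)) :
    row (debias A) i =
      (√2)⁻¹ • (row A (pairIndex m (.inl i)) - row A (pairIndex m (.inr i))) := by
  ext j
  simp [row, debias, pairIndex, div_eq_inv_mul]

theorem norm_toEuclideanLin_debias_le {m n : ℕ} (A : Matrix (Fin m) (Fin n) ℝ)
    (v : EuclideanSpace ℝ (Fin n)) :
    ‖Matrix.toEuclideanLin (debias A) v‖ ≤ ‖Matrix.toEuclideanLin A v‖ := by
  rw [← sq_le_sq₀ (norm_nonneg _) (norm_nonneg _), norm_toEuclideanLin_sq, norm_toEuclideanLin_sq]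
  have hpair : ∀ i, inner ℝ (row (debias A) i) v ^ 2 ≤
      inner ℝ (row A (pairIndex m (.inl i))) v ^ 2 +
        inner ℝ (row A (pairIndex m (.inr i))) v ^ 2 := fun i => by
    rw [row_debias, real_inner_smul_left, mul_pow, inv_pow, Real.sq_sqrt zero_le_two,
      inner_sub_left, inv_mul_le_iff₀ zero_lt_two]
    nlinarith only [sq_nonneg (inner ℝ (row A (pairIndex m (.inl i))) v +
      inner ℝ (row A (pairIndex m (.inr i))) v)]
  calc ∑ i, inner ℝ (row (debias A) i) v ^ 2
      ≤ ∑ i, (inner ℝ (row A (pairIndex m (.inl i))) v ^ 2 +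
          inner ℝ (row A (pairIndex m (.inr i))) v ^ 2) := Finset.sum_le_sum fun i _ => hpair i
    _ = ∑ s, inner ℝ (row A (pairIndex m s)) v ^ 2 := by
        rw [Fintype.sum_sum_type, Finset.sum_add_distrib]
    _ = ∑ j ∈ Finset.univ.map ⟨pairIndex m, pairIndex_injective m⟩, inner ℝ (row A j) v ^ 2 :=
        (Finset.sum_map Finset.univ ⟨pairIndex m, pairIndex_injective m⟩ fun j =>
          inner ℝ (row A j) v ^ 2).symm
    _ ≤ ∑ j, inner ℝ (row A j) v ^ 2 := Finset.sum_le_univ_sum_of_nonneg fun _ => sq_nonneg _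

variable {Ω Ω₀ : Type*} [MeasurableSpace Ω] [MeasurableSpace Ω₀] {μ : Measure Ω} {μ₀ : Measure Ω₀}
  [IsProbabilityMeasure μ₀] {m n : ℕ} {a : Ω₀ → EuclideanSpace ℝ (Fin n)}
  {ν : Measure (EuclideanSpace ℝ (Fin n))} {A : Ω → Matrix (Fin m) (Fin n) ℝ}

theorem measurable_inv_sqrt_two_smul_sub :
    Measurable fun p : EuclideanSpace ℝ (Fin n) × EuclideanSpace ℝ (Fin n) =>
      (√2)⁻¹ • (p.1 - p.2) := by
  fun_prop

theorem hasLaw_debiasedVector (ha : HasLaw a ν μ₀) :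
    HasLaw (debiasedVector a) ((ν.prod ν).map fun p => (√2)⁻¹ • (p.1 - p.2)) (μ₀.prod μ₀) :=
  (measurable_inv_sqrt_two_smul_sub.measurePreserving _).comp_hasLaw (hasLaw_prodMap ha ha)

theorem hasLaw_row_debias [IsProbabilityMeasure μ] [IsProbabilityMeasure ν]
    (hindep : iIndepFun (fun i ω => row (A ω) i) μ) (hA : ∀ i, HasLaw (fun ω => row (A ω) i) ν μ) :
    HasLaw (fun ω => row (debias (A ω)))
      (Measure.pi fun _ => (ν.prod ν).map fun p => (√2)⁻¹ • (p.1 - p.2)) μ := by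
  have hpairs := hasLaw_pi_prod_of_iIndepFun (ν := fun _ => ν)
    (Y := fun s ω => row (A ω) (pairIndex m s))
    (hindep.precomp (pairIndex_injective m)) fun s => hA (pairIndex m s)
  have : IsProbabilityMeasure ((ν.prod ν).map fun p => (√2)⁻¹ • (p.1 - p.2)) :=
    Measure.isProbabilityMeasure_map measurable_inv_sqrt_two_smul_sub.aemeasurable
  have hdiff := measurePreserving_pi (fun _ : Fin (m / 2) => ν.prod ν) _
    fun _ => measurable_inv_sqrt_two_smul_sub.measurePreserving _
  refine (hdiff.comp_hasLaw hpairs).congr (.of_forall fun ω => funext fun i => ?_)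
  exact row_debias (A ω) i

end Debias

end SmallBall

theorem theorem1 {Ω Ω₀ : Type*} [MeasurableSpace Ω] [MeasurableSpace Ω₀]
    (μ : Measure Ω) [IsProbabilityMeasure μ] (μ₀ : Measure Ω₀) [IsProbabilityMeasure μ₀]
    {m n : ℕ} (hm : 1 ≤ m) (E : Set (EuclideanSpace ℝ (Fin n)))
    (a : Ω₀ → EuclideanSpace ℝ (Fin n)) (A : Ω → Matrix (Fin m) (Fin n) ℝ)
    (hindep : iIndepFun (fun i ω => SmallBall.row (A ω) i) μ)
    (hcopies : ∀ i, IdentDistrib (fun ω => SmallBall.row (A ω) i) a μ μ₀)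
    (hW : SmallBall.WExists μ E (fun ω => SmallBall.debias (A ω)))
    (t ξ : ℝ) (ht : 0 < t) (hξ : 0 < ξ) :
    1 - Real.exp (-2 * t ^ 2) ≤
      μ.real {ω |
        ((ξ * √(((m : ℝ) - 1) / 2) *
            SmallBall.Q (μ₀.prod μ₀) (2 * ξ) E (SmallBall.debiasedVector a) - ξ * t : ℝ) : EReal)
          - 2 * SmallBall.W μ E (fun ω => SmallBall.debias (A ω))
        ≤ ⨅ v ∈ E, ((‖Matrix.toEuclideanLin (A ω) v‖ : ℝ) : EReal)} := by
  have ha : HasLaw a (μ₀.map a) μ₀ := ⟨(hcopies ⟨0, hm⟩).aemeasurable_snd, rfl⟩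
  have hA : ∀ i, HasLaw (fun ω => SmallBall.row (A ω) i) (μ₀.map a) μ := fun i =>
    ⟨(hcopies i).aemeasurable_fst, (hcopies i).map_eq⟩
  have : IsProbabilityMeasure (μ₀.map a) := Measure.isProbabilityMeasure_map ha.aemeasurable
  have hb := SmallBall.hasLaw_debiasedVector ha
  have := hb.isProbabilityMeasure_iff.1 inferInstance
  have hQ : 0 ≤ SmallBall.Q (μ₀.prod μ₀) (2 * ξ) E (SmallBall.debiasedVector a) :=
    Real.iInf_nonneg fun _ => measureReal_nonneg
  have hm2 : ((m : ℝ) - 1) / 2 ≤ (m / 2 : ℕ) := by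
    have : (m : ℝ) ≤ 2 * (m / 2 : ℕ) + 1 := by exact_mod_cast (by omega : m ≤ 2 * (m / 2) + 1)
    linarith
  refine (SmallBall.one_sub_exp_le_measureReal_le_iInf_norm
    (SmallBall.hasLaw_row_debias hindep hA) hb hW hξ ht.le).trans
    (measureReal_mono fun ω hω => (EReal.sub_le_sub ?_ le_rfl).trans (hω.trans ?_))
  · exact EReal.coe_le_coe_iff.2 (by gcongr)
  · exact iInf₂_mono fun v _ =>
      EReal.coe_le_coe_iff.2 (SmallBall.norm_toEuclideanLin_debias_le (A ω) v)
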